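/- Let $d\ge 1$ and let $c,v_0\in\mathbb{R}^d$ have all coordinates positive. Put $f(x):=e^{c^\top x}-1$ and, for $u>0$, $Q_u:=v_0+u[0,1]^d$. For a concave function $\mu$ on $Q_u$ with $\mu\ge f$ on $Q_u$, define two sets of points $(x,y,z)\in\mathbb{R}^d\times\mathbb{R}\times\mathbb{R}$. The naive relaxation is $$P^0(f,Q_u,\mu):=\{(x,y,z):\ \tilde\mu(x,z)\ge y\ge f(x),\ x\in zQ_u,\ 0\le z\le 1\},$$ and the perspective relaxation $P(f,Q_u,\mu)$ is the closed convex hull of $$\{(x,y,z):\ \tilde\mu(x,z)\ge y\ge zf(x/z),\ x\in zQ_u,\ 0<z\le 1\}.$$ Here $\tilde\mu(x,z):=z\mu(x/z)$ for $z>0$, and $\tilde\mu(0,0):=0$. Let $\mathrm{vol}$ be Lebesgue measure on $\mathbb{R}^{d+2}$, and let $\Delta_\mu(u):=\mathrm{vol}(P^0(f,Q_u,\mu))-\mathrm{vol}(P(f,Q_u,\mu))$ be the cut-off amount. Consider two upper bounds: the concave envelope $\mathrm{conc}(f)$, i.e. the smallest concave upper bound of $f$ on $Q_u$, and the constant $$F:=\max_{x\in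 Q_u}f(x)=f(v_0+u\mathbf 1)=e^{c^\top v_0}e^{u\,c^\top\mathbf 1}-1 .$$ For every $u>0$ they have the same cut-off amount, $\Delta_{\mathrm{conc}(f)}(u)=\Delta_F(u)=:\Delta(P^0,P)$, and $$\lim_{u\to\infty}u^d\cdot\frac{\Delta(P^0,P)}{\mathrm{vol}(P^0(f,Q_u,\mathrm{conc}(f)))}=\lim_{u\to\infty}u^d\cdot\frac{(d+1)\,\Delta(P^0,P)}{\mathrm{vol}(P^0(f,Q_u,F))}=\frac{d+1}{\prod_{j=1}^d c_j}.$$ In particular, for both upper bounds the cut-off ratio $\Delta(P^0,P)/\mathrm{vol}(P^0)$ tends to $0$ as $u\to\infty$, so the naive relaxation is asymptotically as tight as the perspective relaxation. -/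

import Mathlib

open scoped Pointwise

noncomputable section

namespace BoxRelax

/-- The box `Q_u = v₀ + u [0,1]^d`. -/
def box {d : ℕ} (v₀ : Fin d → ℝ) (u : ℝ) : Set (Fin d → ℝ) :=
  (fun t => v₀ + u • t) '' Set.Icc 0 1

/-- The function `f(x) = e^{cᵀx} - 1`. -/
def expFun {d : ℕ} (c : Fin d → ℝ) (x : Fin d → ℝ) : ℝ :=
  Real.exp (c ⬝ᵥ x) - 1

/-- The perspective function of `f`: `z f(x/z)` for `z > 0`, and `+∞` otherwise, except that
at the origin `(0, 0)` it takes the value `0` of its closure. -/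
def perspective {d : ℕ} (f : (Fin d → ℝ) → ℝ) (x : Fin d → ℝ) (z : ℝ) : EReal :=
  open Classical in
  if 0 < z then ((z * f (z⁻¹ • x) : ℝ) : EReal)
  else if x = 0 ∧ z = 0 then 0
  else ⊤

/-- The upper bound `μ̃`: the negative of the perspective function of `-μ`. -/
def upperPerspective {d : ℕ} (μ : (Fin d → ℝ) → ℝ) (x : Fin d → ℝ) (z : ℝ) : EReal :=
  -perspective (fun w => -μ w) x z

/-- The perspective relaxation `P(f, Q, μ)`, a closed convex hull in the space of
triples `(x, y, z)`. -/
def perspRelaxation {d : ℕ} (f : (Fin d → ℝ) → ℝ) (Q : Set (Fin d → ℝ))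
    (μ : (Fin d → ℝ) → ℝ) : Set ((Fin d → ℝ) × ℝ × ℝ) :=
  closedConvexHull ℝ
    {p | perspective f p.1 p.2.2 ≤ (p.2.1 : EReal) ∧
      (p.2.1 : EReal) ≤ upperPerspective μ p.1 p.2.2 ∧
      p.1 ∈ p.2.2 • Q ∧ 0 < p.2.2 ∧ p.2.2 ≤ 1}

/-- The naive relaxation `P⁰(f, Q, μ)`. -/
def naiveRelaxation {d : ℕ} (f : (Fin d → ℝ) → ℝ) (Q : Set (Fin d → ℝ))
    (μ : (Fin d → ℝ) → ℝ) : Set ((Fin d → ℝ) × ℝ × ℝ) :=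
  {p | f p.1 ≤ p.2.1 ∧ (p.2.1 : EReal) ≤ upperPerspective μ p.1 p.2.2 ∧
    p.1 ∈ p.2.2 • Q ∧ 0 ≤ p.2.2 ∧ p.2.2 ≤ 1}

/-- Lebesgue measure in `ℝ^d × ℝ × ℝ`, as a real number. -/
def vol {d : ℕ} (P : Set ((Fin d → ℝ) × ℝ × ℝ)) : ℝ :=
  (MeasureTheory.volume P).toReal

/-- The cut-off amount `Δ(P⁰, P) = vol(P⁰) - vol(P)`. -/
def cutOff {d : ℕ} (f : (Fin d → ℝ) → ℝ) (Q : Set (Fin d → ℝ)) (μ : (Fin d → ℝ) → ℝ) : ℝ :=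
  vol (naiveRelaxation f Q μ) - vol (perspRelaxation f Q μ)

/-- The cut-off ratio `Δ(P⁰, P) / vol(P⁰)`. -/
def cutOffRatio {d : ℕ} (f : (Fin d → ℝ) → ℝ) (Q : Set (Fin d → ℝ))
    (μ : (Fin d → ℝ) → ℝ) : ℝ :=
  cutOff f Q μ / vol (naiveRelaxation f Q μ)

/-- The maximum of `f` over `Q`, when it is attained. -/
def maxOn {d : ℕ} (f : (Fin d → ℝ) → ℝ) (Q : Set (Fin d → ℝ)) : ℝ :=
  sSup (f '' Q)

/-- `g` is a concave upper bound of `f` on `Q`. -/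
def IsConcaveUpperBound {d : ℕ} (f : (Fin d → ℝ) → ℝ) (Q : Set (Fin d → ℝ))
    (g : (Fin d → ℝ) → ℝ) : Prop :=
  ConcaveOn ℝ Q g ∧ ∀ x ∈ Q, f x ≤ g x

/-- The concave envelope of `f` on `Q`: the smallest concave upper bound, as the pointwise
infimum of all concave upper bounds. Only its values on `Q` are meaningful. -/
def concEnv {d : ℕ} (f : (Fin d → ℝ) → ℝ) (Q : Set (Fin d → ℝ)) (x : Fin d → ℝ) : ℝ :=
  sInf {y | ∃ g, IsConcaveUpperBound f Q g ∧ y = g x}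

theorem concEnv_le {d : ℕ} {f g : (Fin d → ℝ) → ℝ} {Q : Set (Fin d → ℝ)}
    (hg : IsConcaveUpperBound f Q g) {x : Fin d → ℝ} (hx : x ∈ Q) : concEnv f Q x ≤ g x := by
  refine csInf_le ⟨f x, ?_⟩ ⟨g, hg, rfl⟩
  rintro _ ⟨h, hh, rfl⟩
  exact hh.2 x hx

/-- On a convex set on which `f` is bounded above, the concave envelope is itself a concave
upper bound, hence by `concEnv_le` the smallest one. -/
theorem concEnv_isConcaveUpperBound {d : ℕ} {f : (Fin d → ℝ) → ℝ} {Q : Set (Fin d → ℝ)}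
    (hQ : Convex ℝ Q) (hf : BddAbove (f '' Q)) : IsConcaveUpperBound f Q (concEnv f Q) := by
  obtain ⟨M, hM⟩ := hf
  have hMb : IsConcaveUpperBound f Q (fun _ => M) :=
    ⟨concaveOn_const M hQ, fun x hx => hM ⟨x, hx, rfl⟩⟩
  refine ⟨⟨hQ, fun x hx y hy a b ha hb hab => ?_⟩, fun x hx => ?_⟩
  · refine le_csInf ⟨M, _, hMb, rfl⟩ ?_
    rintro _ ⟨g, hg, rfl⟩
    refine le_trans ?_ (hg.1.2 hx hy ha hb hab)
    exact add_le_add (mul_le_mul_of_nonneg_left (concEnv_le hg hx) ha)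
      (mul_le_mul_of_nonneg_left (concEnv_le hg hy) hb)
  · refine le_csInf ⟨M, _, hMb, rfl⟩ ?_
    rintro _ ⟨g, hg, rfl⟩
    exact hg.2 x hx

end BoxRelax

end

namespace BoxRelax

open MeasureTheory Set Filter Topology

/-! Both bodies are cones over subsets of `ℝ^d × ℝ`, up to a piece that does not see `μ`. The
generators of the perspective relaxation form the truncated cone over the band between `f` and `μ`.
This cone is convex, so taking the closed convex hull adds only part of its null frontier. Since `f`
is convex and `f 0 = 0`, one has `0 ≤ f (z w) ≤ z f w` on the box. Hence the naive relaxation is,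
over `z > 0`, the same cone enlarged by the points with `f x ≤ y < z f (x/z)`.

A truncated cone has `1/(d+2)` times the volume of its base. With `N` the volume of `underNaive`,
the cut-off amount is therefore `(∫_Q f)/(d+2) - N` for both upper bounds. The region under `f`
completes the band to the hypograph of `μ` above height `0`, so `vol(P⁰)` is the volume of that
hypograph divided by `d+2`, minus `N`.

Let `k = c ⬝ᵥ (v₀ + u 1)`. The integral of `f` is asymptotic to `e^k / ∏ c_j`, and `N ≤ e^k / (k ∏
c_j)` is of lower order. The hypograph of the constant `F` is a prism of volume `F u^d`. That of the
envelope contains the pyramid over the box with apex `F` above the top corner, of volume `F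
u^d/(d+1)`, and lies in this pyramid raised by `r = ∑ e^(k - u c_j) = o(e^k)`; no formula for the
envelope is needed. Comparing leading terms gives both limits. -/

/-- The cone `{(z w, z y, z) : (w, y) ∈ K, 0 < z ≤ 1}` over `K`. -/
def truncCone {d : ℕ} (K : Set ((Fin d → ℝ) × ℝ)) : Set ((Fin d → ℝ) × ℝ × ℝ) :=
  {p | 0 < p.2.2 ∧ p.2.2 ≤ 1 ∧ (p.2.2⁻¹ • p.1, p.2.2⁻¹ * p.2.1) ∈ K}

/-- The points over `Q` between the graphs of `f` and `μ`. -/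
def band {d : ℕ} (f μ : (Fin d → ℝ) → ℝ) (Q : Set (Fin d → ℝ)) : Set ((Fin d → ℝ) × ℝ) :=
  {p | p.1 ∈ Q ∧ f p.1 ≤ p.2 ∧ p.2 ≤ μ p.1}

/-- The points over `Q` with nonnegative height strictly below the graph of `f`. -/
def under {d : ℕ} (f : (Fin d → ℝ) → ℝ) (Q : Set (Fin d → ℝ)) : Set ((Fin d → ℝ) × ℝ) :=
  {p | p.1 ∈ Q ∧ 0 ≤ p.2 ∧ p.2 < f p.1}

/-- The points `(x, y, z)` with `x ∈ z Q`, `0 < z ≤ 1` and `0 ≤ y < f x`. -/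
def underNaive {d : ℕ} (f : (Fin d → ℝ) → ℝ) (Q : Set (Fin d → ℝ)) :
    Set ((Fin d → ℝ) × ℝ × ℝ) :=
  {p | 0 < p.2.2 ∧ p.2.2 ≤ 1 ∧ p.2.2⁻¹ • p.1 ∈ Q ∧ 0 ≤ p.2.1 ∧ p.2.1 < f p.1}

/-! ### Volume and convexity of truncated cones -/

theorem volume_eq_lintegral_slice {d : ℕ} {A : Set ((Fin d → ℝ) × ℝ × ℝ)}
    (hA : MeasurableSet A) :
    volume A = ∫⁻ z : ℝ, volume {q : (Fin d → ℝ) × ℝ | (q.1, q.2, z) ∈ A} := by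
  have h := (volume_preserving_prodAssoc (α₁ := Fin d → ℝ) (β₁ := ℝ) (γ₁ := ℝ)).measure_preimage
    hA.nullMeasurableSet
  rw [← h, Measure.volume_eq_prod, Measure.prod_apply_symm]
  · rfl
  · exact MeasurableEquiv.prodAssoc.measurable hA

theorem truncCone_mono {d : ℕ} {K L : Set ((Fin d → ℝ) × ℝ)} (h : K ⊆ L) :
    truncCone K ⊆ truncCone L := fun _ hp => ⟨hp.1, hp.2.1, h hp.2.2⟩

theorem measurableSet_truncCone {d : ℕ} {K : Set ((Fin d → ℝ) × ℝ)} (hK : MeasurableSet K) :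
    MeasurableSet (truncCone K) := by
  have h1 : Measurable fun p : (Fin d → ℝ) × ℝ × ℝ => p.2.2 := by fun_prop
  have h2 : Measurable fun p : (Fin d → ℝ) × ℝ × ℝ => (p.2.2⁻¹ • p.1, p.2.2⁻¹ * p.2.1) := by
    fun_prop
  exact (h1 measurableSet_Ioi).inter ((h1 measurableSet_Iic).inter (h2 hK))

/-- The slice at height `z` is `z • K` in dimension `d + 1`, and `∫₀¹ z^(d+1) dz = 1/(d+2)`. -/
theorem volume_truncCone {d : ℕ} {K : Set ((Fin d → ℝ) × ℝ)} (hK : MeasurableSet K) :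
    volume (truncCone K) = ENNReal.ofReal (1 / ((d : ℝ) + 2)) * volume K := by
  have hs : ∀ z : ℝ, volume {q : (Fin d → ℝ) × ℝ | (q.1, q.2, z) ∈ truncCone K} =
      (Ioc (0 : ℝ) 1).indicator (fun z => ENNReal.ofReal (z ^ (d + 1)) * volume K) z := by
    intro z
    by_cases hz : z ∈ Ioc (0 : ℝ) 1
    · rw [indicator_of_mem hz]
      have : {q : (Fin d → ℝ) × ℝ | (q.1, q.2, z) ∈ truncCone K} = z • K := by
        ext q
        rw [mem_smul_set_iff_inv_smul_mem₀ hz.1.ne']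
        exact ⟨fun h => h.2.2, fun h => ⟨hz.1, hz.2, h⟩⟩
      rw [this, Measure.volume_eq_prod, Measure.addHaar_smul]
      congr 3
      simp [Module.finrank_prod, abs_of_pos hz.1]
    · rw [indicator_of_notMem hz]
      have : {q : (Fin d → ℝ) × ℝ | (q.1, q.2, z) ∈ truncCone K} = ∅ := by
        ext q
        simp only [truncCone, mem_ofPred_eq, mem_empty_iff_false, iff_false]
        exact fun h => hz ⟨h.1, h.2.1⟩
      rw [this, measure_empty]
  rw [volume_eq_lintegral_slice (measurableSet_truncCone hK)]
  simp_rw [hs]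
  rw [lintegral_indicator measurableSet_Ioc, lintegral_mul_const _ (by fun_prop)]
  congr 1
  rw [← ofReal_integral_eq_lintegral_ofReal]
  · congr 1
    rw [← intervalIntegral.integral_of_le zero_le_one, integral_pow]
    push_cast
    simp
    ring
  · exact ((continuous_pow (d + 1)).integrableOn_Icc).mono_set Ioc_subset_Icc_self
  · exact (ae_restrict_iff' measurableSet_Ioc).2 (ae_of_all _ fun z hz => pow_nonneg hz.1.le _)

theorem real_volume_truncCone {d : ℕ} {K : Set ((Fin d → ℝ) × ℝ)} (hK : MeasurableSet K) :
    volume.real (truncCone K) = volume.real K / ((d : ℝ) + 2) := by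
  rw [Measure.real, volume_truncCone hK, ENNReal.toReal_mul, ENNReal.toReal_ofReal (by positivity),
    Measure.real]
  ring

theorem volume_truncCone_ne_top {d : ℕ} {K : Set ((Fin d → ℝ) × ℝ)} (hK : MeasurableSet K)
    (h : volume K ≠ ⊤) : volume (truncCone K) ≠ ⊤ := by
  rw [volume_truncCone hK]
  exact ENNReal.mul_ne_top ENNReal.ofReal_ne_top h

theorem convex_truncCone {d : ℕ} {K : Set ((Fin d → ℝ) × ℝ)} (hK : Convex ℝ K) :
    Convex ℝ (truncCone K) := by
  rintro ⟨x, y, z⟩ ⟨hz0, hz1, hK1⟩ ⟨x', y', z'⟩ ⟨hz0', hz1', hK2⟩ a b ha hb hab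
  simp only at hz0 hz1 hK1 hz0' hz1' hK2
  have hw : 0 < a * z + b * z' := by
    rcases ha.eq_or_lt with rfl | ha
    · have : b = 1 := by linarith
      subst this; simpa using hz0'
    · nlinarith [mul_pos ha hz0, mul_nonneg hb hz0'.le]
  refine ⟨by simpa using hw, by simp; nlinarith, ?_⟩
  -- Dividing a combination of two cone points by its new height reweights the base points by `a z`
  -- and `b z'`, normalised.
  have h := hK hK1 hK2 (a := a * z / (a * z + b * z')) (b := b * z' / (a * z + b * z'))
    (by positivity) (by positivity) (by field_simp)
  convert h using 1
  ext j
  · simp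
    field_simp
  · simp
    field_simp

/-! ### The two relaxations in terms of cones -/

theorem perspective_of_pos {d : ℕ} (f : (Fin d → ℝ) → ℝ) (x : Fin d → ℝ) {z : ℝ} (hz : 0 < z) :
    perspective f x z = ((z * f (z⁻¹ • x) : ℝ) : EReal) := by
  simp [perspective, hz]

theorem upperPerspective_of_pos {d : ℕ} (μ : (Fin d → ℝ) → ℝ) (x : Fin d → ℝ) {z : ℝ}
    (hz : 0 < z) : upperPerspective μ x z = ((z * μ (z⁻¹ • x) : ℝ) : EReal) := by
  rw [upperPerspective, perspective_of_pos _ _ hz, ← EReal.coe_neg]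
  congr 1
  ring

theorem mem_truncCone_band {d : ℕ} {f μ : (Fin d → ℝ) → ℝ} {Q : Set (Fin d → ℝ)}
    {p : (Fin d → ℝ) × ℝ × ℝ} : p ∈ truncCone (band f μ Q) ↔
      0 < p.2.2 ∧ p.2.2 ≤ 1 ∧ p.2.2⁻¹ • p.1 ∈ Q ∧ p.2.2 * f (p.2.2⁻¹ • p.1) ≤ p.2.1 ∧
        p.2.1 ≤ p.2.2 * μ (p.2.2⁻¹ • p.1) := by
  simp only [truncCone, band, mem_ofPred_eq]
  refine and_congr_right fun hz => and_congr_right fun _ => and_congr_right fun _ => ?_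
  rw [le_inv_mul_iff₀ hz, inv_mul_le_iff₀ hz]

theorem mem_truncCone_under {d : ℕ} {f : (Fin d → ℝ) → ℝ} {Q : Set (Fin d → ℝ)}
    {p : (Fin d → ℝ) × ℝ × ℝ} : p ∈ truncCone (under f Q) ↔
      0 < p.2.2 ∧ p.2.2 ≤ 1 ∧ p.2.2⁻¹ • p.1 ∈ Q ∧ 0 ≤ p.2.1 ∧
        p.2.1 < p.2.2 * f (p.2.2⁻¹ • p.1) := by
  simp only [truncCone, under, mem_ofPred_eq]
  refine and_congr_right fun hz => and_congr_right fun _ => and_congr_right fun _ => ?_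
  rw [inv_mul_lt_iff₀ hz, mul_nonneg_iff_of_pos_left (inv_pos.2 hz)]

theorem perspRelaxation_eq_closedConvexHull_truncCone {d : ℕ} (f μ : (Fin d → ℝ) → ℝ)
    (Q : Set (Fin d → ℝ)) :
    perspRelaxation f Q μ = closedConvexHull ℝ (truncCone (band f μ Q)) := by
  rw [perspRelaxation]
  refine congrArg (fun s => (closedConvexHull ℝ s : Set _)) (Set.ext fun p => ?_)
  rw [mem_truncCone_band]
  simp only [mem_ofPred_eq]
  by_cases hz : 0 < p.2.2
  · rw [perspective_of_pos _ _ hz, upperPerspective_of_pos _ _ hz, EReal.coe_le_coe_iff,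
      EReal.coe_le_coe_iff, mem_smul_set_iff_inv_smul_mem₀ hz.ne']
    tauto
  · tauto

theorem convex_band {d : ℕ} {f μ : (Fin d → ℝ) → ℝ} {Q : Set (Fin d → ℝ)}
    (hf : ConvexOn ℝ Q f) (hμ : ConcaveOn ℝ Q μ) : Convex ℝ (band f μ Q) := by
  have : band f μ Q = {p | p.1 ∈ Q ∧ f p.1 ≤ p.2} ∩ {p | p.1 ∈ Q ∧ p.2 ≤ μ p.1} := by
    ext p
    simp only [band, mem_ofPred_eq, mem_inter_iff]
    tauto
  rw [this]
  exact hf.convex_epigraph.inter hμ.convex_hypograph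

/-- The frontier of a convex set is null, so the closure of the convex cone has the volume of the
cone itself. -/
theorem vol_perspRelaxation {d : ℕ} {f μ : (Fin d → ℝ) → ℝ} {Q : Set (Fin d → ℝ)}
    (hf : ConvexOn ℝ Q f) (hμ : ConcaveOn ℝ Q μ) :
    vol (perspRelaxation f Q μ) = volume.real (truncCone (band f μ Q)) := by
  have hc := convex_truncCone (convex_band hf hμ)
  have hfr : volume (frontier (truncCone (band f μ Q))) = 0 := by
    have : (volume : Measure (ℝ × ℝ)).IsAddHaarMeasure :=
      Measure.prod.instIsAddHaarMeasure volume volume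
    have : (volume : Measure ((Fin d → ℝ) × ℝ × ℝ)).IsAddHaarMeasure :=
      Measure.prod.instIsAddHaarMeasure volume volume
    exact hc.addHaar_frontier _
  rw [perspRelaxation_eq_closedConvexHull_truncCone, closedConvexHull_eq_closure_convexHull,
    hc.convexHull_eq, vol, Measure.real]
  congr 1
  refine le_antisymm ?_ (measure_mono subset_closure)
  rw [closure_eq_self_union_frontier]
  exact (measure_union_le _ _).trans (by rw [hfr, add_zero])

/-- Away from the hyperplane `z = 0`, the naive relaxation splits into the truncated cone of the
perspective relaxation and a part that does not depend on the upper bound. -/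
theorem naiveRelaxation_inter_pos {d : ℕ} {f μ : (Fin d → ℝ) → ℝ} {Q : Set (Fin d → ℝ)}
    (hfμ : ∀ x ∈ Q, f x ≤ μ x)
    (hpos : ∀ x ∈ Q, ∀ z : ℝ, 0 < z → z ≤ 1 → 0 ≤ f (z • x) ∧ f (z • x) ≤ z * f x) :
    naiveRelaxation f Q μ ∩ {p | 0 < p.2.2} =
      truncCone (band f μ Q) ∪ (truncCone (under f Q) \ underNaive f Q) := by
  ext p
  obtain ⟨x, y, z⟩ := p
  rw [mem_union, Set.mem_sdiff, mem_truncCone_band, mem_truncCone_under]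
  simp only [naiveRelaxation, underNaive, mem_inter_iff, mem_ofPred_eq]
  by_cases hz : 0 < z
  · rw [upperPerspective_of_pos _ _ hz, EReal.coe_le_coe_iff,
      mem_smul_set_iff_inv_smul_mem₀ hz.ne']
    by_cases hz1 : z ≤ 1
    · by_cases hx : z⁻¹ • x ∈ Q
      · have h := hpos _ hx z hz hz1
        rw [smul_inv_smul₀ hz.ne'] at h
        have h2 := mul_le_mul_of_nonneg_left (hfμ _ hx) hz.le
        simp only [hz, hz1, hx, true_and, hz.le, and_true]
        constructor
        · rintro ⟨h3, h4⟩
          -- The perspective value separates the cone over the band from the extra piece.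
          rcases le_or_gt (z * f (z⁻¹ • x)) y with h5 | h5
          · exact Or.inl ⟨h5, h4⟩
          · exact Or.inr ⟨⟨h.1.trans h3, h5⟩, fun h6 => absurd h6.2 h3.not_gt⟩
        · rintro (⟨h3, h4⟩ | ⟨⟨h3, h4⟩, h5⟩)
          · exact ⟨h.2.trans h3, h4⟩
          · exact ⟨not_lt.1 fun h6 => h5 ⟨h3, h6⟩, h4.le.trans h2⟩
      · tauto
    · tauto
  · tauto

theorem volume_setOf_height_eq_zero {d : ℕ} :
    volume {p : (Fin d → ℝ) × ℝ × ℝ | p.2.2 = 0} = 0 := by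
  have h : MeasurableSet {p : (Fin d → ℝ) × ℝ × ℝ | p.2.2 = 0} :=
    (measurableSet_singleton (0 : ℝ)).preimage (by fun_prop)
  rw [volume_eq_lintegral_slice h, lintegral_eq_zero_iff' (by
    have : (fun z : ℝ => volume {q : (Fin d → ℝ) × ℝ | (q.1, q.2, z) ∈
      {p : (Fin d → ℝ) × ℝ × ℝ | p.2.2 = 0}}) = ({0} : Set ℝ).indicator 
        (fun _ => volume (univ : Set ((Fin d → ℝ) × ℝ))) := by
      ext z
      by_cases hz : z = 0 <;> simp [hz]
    rw [this]
    exact (measurable_const.indicator (measurableSet_singleton 0)).aemeasurable)]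
  filter_upwards [compl_mem_ae_iff.2 (measure_singleton (0 : ℝ))] with z hz
  have : z ≠ 0 := hz
  simp [this]

theorem vol_naiveRelaxation {d : ℕ} {f μ : (Fin d → ℝ) → ℝ} {Q : Set (Fin d → ℝ)}
    (hfμ : ∀ x ∈ Q, f x ≤ μ x)
    (hpos : ∀ x ∈ Q, ∀ z : ℝ, 0 < z → z ≤ 1 → 0 ≤ f (z • x) ∧ f (z • x) ≤ z * f x)
    (hU : MeasurableSet (under f Q)) (hUfin : volume (under f Q) ≠ ⊤)
    (hN : MeasurableSet (underNaive f Q)) (hB : volume (truncCone (band f μ Q)) ≠ ⊤) :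
    vol (naiveRelaxation f Q μ) = volume.real (truncCone (band f μ Q)) +
      (volume.real (truncCone (under f Q)) - volume.real (underNaive f Q)) := by
  have hsub : underNaive f Q ⊆ truncCone (under f Q) := by
    rintro ⟨x, y, z⟩ ⟨h1, h2, h3, h4, h5⟩
    rw [mem_truncCone_under]
    refine ⟨h1, h2, h3, h4, h5.trans_le ?_⟩
    have h := (hpos _ h3 z h1 h2).2
    rwa [smul_inv_smul₀ h1.ne'] at h
  have hT := measurableSet_truncCone hU
  have hTfin := volume_truncCone_ne_top hU hUfin
  have hdisj : Disjoint (truncCone (band f μ Q)) (truncCone (under f Q) \ underNaive f Q) := by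
    rw [disjoint_left]
    intro p h1 h2
    rw [mem_truncCone_band] at h1
    have h3 := mem_truncCone_under.1 h2.1
    exact absurd h1.2.2.2.1 h3.2.2.2.2.not_ge
  rw [← measureReal_sdiff hsub hN hTfin,
    ← measureReal_union hdisj (hT.diff hN) hB (measure_ne_top_of_subset sdiff_subset hTfin),
    ← naiveRelaxation_inter_pos hfμ hpos, vol, Measure.real]
  congr 1
  refine le_antisymm ?_ (measure_mono inter_subset_left)
  have : naiveRelaxation f Q μ ⊆
      (naiveRelaxation f Q μ ∩ {p | 0 < p.2.2}) ∪ {p | p.2.2 = 0} := by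
    intro p hp
    rcases hp.2.2.2.1.eq_or_lt with h | h
    · exact Or.inr h.symm
    · exact Or.inl ⟨hp, h⟩
  refine (measure_mono this).trans ((measure_union_le _ _).trans ?_)
  rw [volume_setOf_height_eq_zero, add_zero]

/-- The graph of `f` cuts the hypograph of `μ` above height `0` into the band and the region under
`f`; coning preserves this partition. -/
theorem real_volume_truncCone_hypograph {d : ℕ} {f μ : (Fin d → ℝ) → ℝ} {Q : Set (Fin d → ℝ)}
    (hfμ : ∀ x ∈ Q, f x ≤ μ x) (hf : ∀ x ∈ Q, 0 ≤ f x)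
    (hU : MeasurableSet (under f Q)) (hUfin : volume (under f Q) ≠ ⊤)
    (hB : volume (truncCone (band f μ Q)) ≠ ⊤) :
    volume.real (truncCone (band 0 μ Q)) =
      volume.real (truncCone (band f μ Q)) + volume.real (truncCone (under f Q)) := by
  rw [← measureReal_union _ (measurableSet_truncCone hU) hB (volume_truncCone_ne_top hU hUfin)]
  · congr 1
    ext p
    simp only [truncCone, band, under, mem_union, mem_ofPred_eq, Pi.zero_apply]
    constructor
    · rintro ⟨h1, h2, h3, h4, h5⟩
      rcases le_or_gt (f (p.2.2⁻¹ • p.1)) (p.2.2⁻¹ * p.2.1) with h | h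
      · exact Or.inl ⟨h1, h2, h3, h, h5⟩
      · exact Or.inr ⟨h1, h2, h3, h4, h⟩
    · rintro (⟨h1, h2, h3, h4, h5⟩ | ⟨h1, h2, h3, h4, h5⟩)
      · exact ⟨h1, h2, h3, (hf _ h3).trans h4, h5⟩
      · exact ⟨h1, h2, h3, h4, h5.le.trans (hfμ _ h3)⟩
  · rw [disjoint_left]
    intro p h1 h2
    exact absurd h1.2.2.2.1 h2.2.2.2.2.not_ge

/-- The cone over the band is common to both volumes and cancels, which removes `μ`. -/
theorem cutOff_eq {d : ℕ} {f μ : (Fin d → ℝ) → ℝ} {Q : Set (Fin d → ℝ)}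
    (hf : ConvexOn ℝ Q f) (hμ : IsConcaveUpperBound f Q μ)
    (hpos : ∀ x ∈ Q, ∀ z : ℝ, 0 < z → z ≤ 1 → 0 ≤ f (z • x) ∧ f (z • x) ≤ z * f x)
    (hU : MeasurableSet (under f Q)) (hUfin : volume (under f Q) ≠ ⊤)
    (hN : MeasurableSet (underNaive f Q)) (hB : volume (truncCone (band f μ Q)) ≠ ⊤) :
    cutOff f Q μ = volume.real (under f Q) / ((d : ℝ) + 2) - volume.real (underNaive f Q) := by
  rw [cutOff, vol_perspRelaxation hf hμ.1, vol_naiveRelaxation hμ.2 hpos hU hUfin hN hB,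
    real_volume_truncCone hU]
  ring

theorem vol_naiveRelaxation_eq {d : ℕ} {f μ : (Fin d → ℝ) → ℝ} {Q : Set (Fin d → ℝ)}
    (hμ : IsConcaveUpperBound f Q μ)
    (hpos : ∀ x ∈ Q, ∀ z : ℝ, 0 < z → z ≤ 1 → 0 ≤ f (z • x) ∧ f (z • x) ≤ z * f x)
    (hU : MeasurableSet (under f Q)) (hUfin : volume (under f Q) ≠ ⊤)
    (hN : MeasurableSet (underNaive f Q)) (hB : volume (truncCone (band f μ Q)) ≠ ⊤) :
    vol (naiveRelaxation f Q μ) =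
      volume.real (truncCone (band 0 μ Q)) - volume.real (underNaive f Q) := by
  have hf : ∀ x ∈ Q, 0 ≤ f x := fun x hx => by
    simpa using (hpos x hx 1 one_pos le_rfl).1
  rw [vol_naiveRelaxation hμ.2 hpos hU hUfin hN hB,
    real_volume_truncCone_hypograph hμ.2 hf hU hUfin hB]
  ring

/-! ### The exponential on a box -/

theorem box_eq_Icc {d : ℕ} (v : Fin d → ℝ) {u : ℝ} (hu : 0 < u) :
    box v u = Icc v (v + u • (1 : Fin d → ℝ)) := by
  ext x
  simp only [box, mem_image, mem_Icc, Pi.le_def]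
  constructor
  · rintro ⟨t, ⟨h0, h1⟩, rfl⟩
    constructor <;> intro j
    · simpa using mul_nonneg hu.le (h0 j)
    · simpa using mul_le_of_le_one_right hu.le (h1 j)
  · rintro ⟨h0, h1⟩
    refine ⟨u⁻¹ • (x - v), ⟨fun j => ?_, fun j => ?_⟩, ?_⟩
    · simpa using mul_nonneg (inv_nonneg.2 hu.le) (sub_nonneg.2 (h0 j))
    · have := h1 j
      simp only [Pi.add_apply, Pi.smul_apply, Pi.one_apply, smul_eq_mul, mul_one] at this
      simp only [Pi.smul_apply, Pi.sub_apply, smul_eq_mul, Pi.one_apply]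
      rw [inv_mul_le_iff₀ hu]
      linarith
    · rw [smul_inv_smul₀ hu.ne']
      simp

theorem convex_box {d : ℕ} (v : Fin d → ℝ) {u : ℝ} (hu : 0 < u) : Convex ℝ (box v u) := by
  rw [box_eq_Icc v hu]
  exact convex_Icc _ _

theorem volume_box {d : ℕ} (v : Fin d → ℝ) {u : ℝ} (hu : 0 < u) :
    volume (box v u) = ENNReal.ofReal (u ^ d) := by
  rw [box_eq_Icc v hu, Real.volume_Icc_pi]
  simp [ENNReal.ofReal_pow hu.le]

theorem continuous_expFun {d : ℕ} (c : Fin d → ℝ) : Continuous (expFun c) := by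
  unfold expFun dotProduct
  fun_prop

theorem convexOn_expFun {d : ℕ} (c : Fin d → ℝ) : ConvexOn ℝ univ (expFun c) := by
  refine ⟨convex_univ, fun x _ y _ a b ha hb hab => ?_⟩
  have h := convexOn_exp.2 (mem_univ (c ⬝ᵥ x)) (mem_univ (c ⬝ᵥ y)) ha hb hab
  simp only [smul_eq_mul] at h
  simp only [expFun, dotProduct_add, dotProduct_smul, smul_eq_mul]
  linear_combination h + hab

theorem measurableSet_under {d : ℕ} {f : (Fin d → ℝ) → ℝ} {Q : Set (Fin d → ℝ)}
    (hf : Measurable f) (hQ : MeasurableSet Q) : MeasurableSet (under f Q) :=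
  (measurable_fst hQ).inter ((measurableSet_le measurable_const measurable_snd).inter
    (measurableSet_lt measurable_snd (hf.comp measurable_fst)))

theorem measurableSet_underNaive {d : ℕ} {f : (Fin d → ℝ) → ℝ} {Q : Set (Fin d → ℝ)}
    (hf : Measurable f) (hQ : MeasurableSet Q) : MeasurableSet (underNaive f Q) := by
  have h1 : Measurable fun p : (Fin d → ℝ) × ℝ × ℝ => p.2.2 := by fun_prop
  have h2 : Measurable fun p : (Fin d → ℝ) × ℝ × ℝ => p.2.2⁻¹ • p.1 := by fun_prop
  have h3 : Measurable fun p : (Fin d → ℝ) × ℝ × ℝ => p.2.1 := by fun_prop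
  exact (h1 measurableSet_Ioi).inter ((h1 measurableSet_Iic).inter ((h2 hQ).inter
    ((measurableSet_le measurable_const h3).inter
      (measurableSet_lt h3 (hf.comp measurable_fst)))))

theorem volume_under {d : ℕ} {f : (Fin d → ℝ) → ℝ} {Q : Set (Fin d → ℝ)}
    (hf : Measurable f) (hQ : MeasurableSet Q) (hint : IntegrableOn f Q)
    (h0 : ∀ x ∈ Q, 0 ≤ f x) : volume (under f Q) = ENNReal.ofReal (∫ x in Q, f x) := by
  rw [ofReal_integral_eq_lintegral_ofReal hint
      ((ae_restrict_iff' hQ).2 (ae_of_all _ h0)), ← lintegral_indicator hQ,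
    Measure.volume_eq_prod, Measure.prod_apply (measurableSet_under hf hQ)]
  refine lintegral_congr fun x => ?_
  by_cases hx : x ∈ Q
  · rw [indicator_of_mem hx]
    have : Prod.mk x ⁻¹' under f Q = Ico 0 (f x) := by
      ext y
      exact ⟨fun h => h.2, fun h => ⟨hx, h⟩⟩
    rw [this, Real.volume_Ico, sub_zero]
  · rw [indicator_of_notMem hx]
    have : Prod.mk x ⁻¹' under f Q = ∅ := by
      ext y
      exact ⟨fun h => hx h.1, fun h => h.elim⟩
    rw [this, measure_empty]

theorem integral_exp_dotProduct_Icc {d : ℕ} {c a b : Fin d → ℝ} (hc : ∀ j, 0 < c j)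
    (hab : a ≤ b) : ∫ x in Icc a b, Real.exp (c ⬝ᵥ x) =
      ∏ j, (Real.exp (c j * b j) - Real.exp (c j * a j)) / c j := by
  rw [← pi_univ_Icc, volume_pi, Measure.restrict_pi_pi]
  simp only [dotProduct, Real.exp_sum]
  rw [integral_fintype_prod_eq_prod (fun j x => Real.exp (c j * x))]
  refine Finset.prod_congr rfl fun j _ => ?_
  rw [integral_Icc_eq_integral_Ioc, ← intervalIntegral.integral_of_le (hab j),
    intervalIntegral.integral_comp_mul_left _ (hc j).ne', integral_exp, smul_eq_mul]
  ring

/-- Each one-dimensional factor only grows when the lower-endpoint term is dropped. -/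
theorem integral_exp_dotProduct_Icc_le {d : ℕ} {c a b : Fin d → ℝ} (hc : ∀ j, 0 < c j)
    (hab : a ≤ b) : ∫ x in Icc a b, Real.exp (c ⬝ᵥ x) ≤ Real.exp (c ⬝ᵥ b) / ∏ j, c j := by
  rw [integral_exp_dotProduct_Icc hc hab, dotProduct, Real.exp_sum, ← Finset.prod_div_distrib]
  refine Finset.prod_le_prod (fun j _ => ?_) fun j _ => ?_
  · refine div_nonneg (sub_nonneg.2 (Real.exp_le_exp.2 ?_)) (hc j).le
    exact mul_le_mul_of_nonneg_left (hab j) (hc j).le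
  · exact div_le_div_of_nonneg_right (by linarith [Real.exp_pos (c j * a j)]) (hc j).le

theorem expFun_nonneg {d : ℕ} {c x : Fin d → ℝ} (hc : ∀ j, 0 < c j) (hx : 0 ≤ x) :
    0 ≤ expFun c x := by
  rw [expFun, sub_nonneg, Real.one_le_exp_iff]
  exact Finset.sum_nonneg fun j _ => mul_nonneg (hc j).le (hx j)

/-- Convexity along the segment from `0` to `x`, with `f 0 = 0`. -/
theorem expFun_smul_bounds {d : ℕ} {c x : Fin d → ℝ} (hc : ∀ j, 0 < c j) (hx : 0 ≤ x) {z : ℝ}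
    (hz : 0 < z) (hz1 : z ≤ 1) :
    0 ≤ expFun c (z • x) ∧ expFun c (z • x) ≤ z * expFun c x := by
  refine ⟨expFun_nonneg hc (smul_nonneg hz.le hx), ?_⟩
  have h := (convexOn_expFun c).2 (mem_univ x) (mem_univ 0) hz.le (sub_nonneg.2 hz1)
    (add_sub_cancel _ _)
  simpa [expFun] using h

theorem nonneg_of_mem_box {d : ℕ} {v : Fin d → ℝ} (hv : ∀ j, 0 < v j) {u : ℝ} (hu : 0 < u)
    {x : Fin d → ℝ} (hx : x ∈ box v u) : 0 ≤ x := by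
  rw [box_eq_Icc v hu] at hx
  exact fun j => (hv j).le.trans (hx.1 j)

theorem measurableSet_box {d : ℕ} (v : Fin d → ℝ) {u : ℝ} (hu : 0 < u) :
    MeasurableSet (box v u) := by
  rw [box_eq_Icc v hu]
  exact measurableSet_Icc

theorem volume_under_expFun_box {d : ℕ} {c v : Fin d → ℝ} (hc : ∀ j, 0 < c j)
    (hv : ∀ j, 0 < v j) {u : ℝ} (hu : 0 < u) :
    volume (under (expFun c) (box v u)) =
      ENNReal.ofReal (∫ x in box v u, expFun c x) := by
  refine volume_under (continuous_expFun c).measurable (measurableSet_box v hu) ?_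
    fun x hx => expFun_nonneg hc (nonneg_of_mem_box hv hu hx)
  rw [box_eq_Icc v hu]
  exact (continuous_expFun c).integrableOn_Icc

theorem integral_expFun_box {d : ℕ} {c v : Fin d → ℝ} (hc : ∀ j, 0 < c j)
    {u : ℝ} (hu : 0 < u) :
    ∫ x in box v u, expFun c x =
      (∏ j, (Real.exp (c j * (v j + u)) - Real.exp (c j * v j)) / c j) - u ^ d := by
  have hle : v ≤ v + u • (1 : Fin d → ℝ) := by
    intro j
    simp [hu.le]
  have hvol := volume_box v hu
  rw [box_eq_Icc v hu] at hvol ⊢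
  simp only [expFun]
  rw [integral_sub, integral_exp_dotProduct_Icc hc hle]
  · simp [Measure.real, hvol, hu.le]
  · have : Continuous fun x : Fin d → ℝ => Real.exp (c ⬝ᵥ x) := by
      unfold dotProduct
      fun_prop
    exact this.integrableOn_Icc
  · exact continuous_const.integrableOn_Icc

/-- The slice at height `z` lies under `f` over the scaled box, whose top corner has exponent `k z`,
so its volume is at most `e^(kz) / ∏ c_j`. Integrating over `z` gains the factor `1/k` that makes
this region negligible. -/
theorem volume_underNaive_le {d : ℕ} {c v : Fin d → ℝ} (hc : ∀ j, 0 < c j)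
    (hv : ∀ j, 0 < v j) {u : ℝ} (hu : 0 < u) {k : ℝ} (hk : 0 < k)
    (hkeq : k = c ⬝ᵥ (v + u • (1 : Fin d → ℝ))) :
    volume (underNaive (expFun c) (box v u)) ≤
      ENNReal.ofReal (Real.exp k / (k * ∏ j, c j)) := by
  have hle : v ≤ v + u • (1 : Fin d → ℝ) := by
    intro j
    simp [hu.le]
  have hcp : 0 < ∏ j, c j := Finset.prod_pos fun j _ => hc j
  have hs : ∀ z : ℝ, volume {q : (Fin d → ℝ) × ℝ | (q.1, q.2, z) ∈
      underNaive (expFun c) (box v u)} ≤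
      (Ioc (0 : ℝ) 1).indicator (fun z => ENNReal.ofReal (Real.exp (k * z) / ∏ j, c j)) z := by
    intro z
    by_cases hz : z ∈ Ioc (0 : ℝ) 1
    · rw [indicator_of_mem hz]
      have hsub : {q : (Fin d → ℝ) × ℝ | (q.1, q.2, z) ∈ underNaive (expFun c) (box v u)} ⊆
          under (expFun c) (Icc (z • v) (z • (v + u • (1 : Fin d → ℝ)))) := by
        rintro ⟨x, y⟩ ⟨h1, -, h3, h4⟩
        refine ⟨?_, h4⟩
        simp only [box_eq_Icc v hu] at h3 h1
        constructor
        · have := smul_le_smul_of_nonneg_left h3.1 h1.le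
          rwa [smul_inv_smul₀ h1.ne'] at this
        · have := smul_le_smul_of_nonneg_left h3.2 h1.le
          rwa [smul_inv_smul₀ h1.ne'] at this
      refine (measure_mono hsub).trans ?_
      have h0 : ∀ x ∈ Icc (z • v) (z • (v + u • (1 : Fin d → ℝ))), 0 ≤ expFun c x :=
        fun x hx => expFun_nonneg hc (le_trans (smul_nonneg hz.1.le fun j => (hv j).le) hx.1)
      rw [volume_under (continuous_expFun c).measurable measurableSet_Icc
        (continuous_expFun c).integrableOn_Icc h0]
      refine ENNReal.ofReal_le_ofReal ?_
      have hexp : Continuous fun x : Fin d → ℝ => Real.exp (c ⬝ᵥ x) := by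
        unfold dotProduct
        fun_prop
      calc ∫ x in Icc (z • v) (z • (v + u • (1 : Fin d → ℝ))), expFun c x
          ≤ ∫ x in Icc (z • v) (z • (v + u • (1 : Fin d → ℝ))), Real.exp (c ⬝ᵥ x) :=
            setIntegral_mono (continuous_expFun c).integrableOn_Icc hexp.integrableOn_Icc
              fun x => sub_le_self _ zero_le_one
        _ ≤ Real.exp (c ⬝ᵥ (z • (v + u • (1 : Fin d → ℝ)))) / ∏ j, c j :=
            integral_exp_dotProduct_Icc_le hc (smul_le_smul_of_nonneg_left hle hz.1.le)
        _ = Real.exp (k * z) / ∏ j, c j := by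
            rw [dotProduct_smul, ← hkeq, smul_eq_mul, mul_comm]
    · rw [indicator_of_notMem hz]
      have : {q : (Fin d → ℝ) × ℝ | (q.1, q.2, z) ∈ underNaive (expFun c) (box v u)} = ∅ := by
        ext q
        simp only [underNaive, mem_ofPred_eq, mem_empty_iff_false, iff_false]
        exact fun h => hz ⟨h.1, h.2.1⟩
      rw [this, measure_empty]
  rw [volume_eq_lintegral_slice (measurableSet_underNaive (continuous_expFun c).measurable
    (measurableSet_box v hu))]
  refine (lintegral_mono hs).trans ?_
  have hcont : Continuous fun z : ℝ => Real.exp (k * z) / ∏ j, c j := by fun_prop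
  rw [lintegral_indicator measurableSet_Ioc, ← ofReal_integral_eq_lintegral_ofReal
    (hcont.integrableOn_Icc.mono_set Ioc_subset_Icc_self)
    (ae_of_all _ fun z => div_nonneg (Real.exp_pos _).le hcp.le)]
  refine ENNReal.ofReal_le_ofReal ?_
  rw [← intervalIntegral.integral_of_le zero_le_one, intervalIntegral.integral_div,
    intervalIntegral.integral_comp_mul_left _ hk.ne', integral_exp, smul_eq_mul, mul_one, mul_zero,
    Real.exp_zero, inv_mul_eq_div, div_div]
  exact div_le_div_of_nonneg_right (by linarith) (by positivity)

/-! ### Pyramids over the box -/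

/-- The points over the box with nonnegative height below all the functions
`r + F (x j - v j) / u`. -/
def pyramid {d : ℕ} (v : Fin d → ℝ) (u F r : ℝ) : Set ((Fin d → ℝ) × ℝ) :=
  {p | p.1 ∈ box v u ∧ 0 ≤ p.2 ∧ ∀ j, p.2 ≤ r + F * ((p.1 j - v j) / u)}

theorem measurableSet_pyramid {d : ℕ} (v : Fin d → ℝ) {u : ℝ} (hu : 0 < u) (F r : ℝ) :
    MeasurableSet (pyramid v u F r) := by
  refine (measurable_fst (measurableSet_box v hu)).inter
    ((measurableSet_le measurable_const measurable_snd).inter ?_)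
  have : {p : (Fin d → ℝ) × ℝ | ∀ j, p.2 ≤ r + F * ((p.1 j - v j) / u)} =
      ⋂ j, {p : (Fin d → ℝ) × ℝ | p.2 ≤ r + F * ((p.1 j - v j) / u)} := by
    ext p
    simp
  change MeasurableSet {p : (Fin d → ℝ) × ℝ | ∀ j, p.2 ≤ r + F * ((p.1 j - v j) / u)}
  rw [this]
  exact MeasurableSet.iInter fun j => measurableSet_le measurable_snd (by fun_prop)

/-- The horizontal slice at height `y` is a cube of side `u (1 - y/F)` sharing the top corner of the
box. -/
theorem volume_pyramid {d : ℕ} (hd : 1 ≤ d) (v : Fin d → ℝ) {u F : ℝ} (hu : 0 < u)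
    (hF : 0 < F) : volume (pyramid v u F 0) = ENNReal.ofReal (F * u ^ d / ((d : ℝ) + 1)) := by
  have hs : ∀ y : ℝ, volume ((fun x => (x, y)) ⁻¹' pyramid v u F 0) =
      (Icc (0 : ℝ) F).indicator (fun y => ENNReal.ofReal ((u - u * (y / F)) ^ d)) y := by
    intro y
    by_cases hy : y ∈ Icc (0 : ℝ) F
    · rw [indicator_of_mem hy]
      have hyF : 0 ≤ y / F := div_nonneg hy.1 hF.le
      have hyF1 : y / F ≤ 1 := (div_le_one hF).2 hy.2
      have : (fun x => (x, y)) ⁻¹' pyramid v u F 0 =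
          Icc (v + (u * (y / F)) • (1 : Fin d → ℝ)) (v + u • (1 : Fin d → ℝ)) := by
        ext x
        simp only [pyramid, box_eq_Icc v hu, mem_preimage, mem_ofPred_eq, mem_Icc, Pi.le_def,
          Pi.add_apply, Pi.smul_apply, Pi.one_apply, smul_eq_mul, mul_one, zero_add]
        have key : ∀ j, y ≤ F * ((x j - v j) / u) ↔ v j + u * (y / F) ≤ x j := by
          intro j
          rw [← div_le_iff₀' hF, le_div_iff₀ hu, le_sub_iff_add_le]
          rw [mul_comm, add_comm]
        simp only [key]
        constructor
        · rintro ⟨⟨_, h2⟩, _, h4⟩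
          exact ⟨h4, h2⟩
        · rintro ⟨h1, h2⟩
          exact ⟨⟨fun j => by nlinarith [h1 j, mul_nonneg hu.le hyF], h2⟩, hy.1, h1⟩
      rw [this, Real.volume_Icc_pi, ENNReal.ofReal_pow (by nlinarith)]
      simp
    · rw [indicator_of_notMem hy]
      have : (fun x => (x, y)) ⁻¹' pyramid v u F 0 = ∅ := by
        ext x
        simp only [pyramid, box_eq_Icc v hu, mem_preimage, mem_ofPred_eq, mem_empty_iff_false,
          iff_false]
        rintro ⟨h1, h2, h3⟩
        -- The height is bounded only through a coordinate, so `d ≥ 1` is essential.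
        refine hy ⟨h2, (h3 ⟨0, hd⟩).trans ?_⟩
        rw [zero_add]
        refine mul_le_of_le_one_right hF.le ((div_le_one hu).2 ?_)
        have := h1.2 ⟨0, hd⟩
        simp only [Pi.add_apply, Pi.smul_apply, Pi.one_apply, smul_eq_mul, mul_one] at this
        linarith
      rw [this, measure_empty]
  rw [Measure.volume_eq_prod, Measure.prod_apply_symm (measurableSet_pyramid v hu F 0)]
  simp_rw [hs]
  have hcont : Continuous fun y : ℝ => (u - u * (y / F)) ^ d := by fun_prop
  rw [lintegral_indicator measurableSet_Icc, ← ofReal_integral_eq_lintegral_ofReal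
    hcont.integrableOn_Icc]
  · congr 1
    rw [integral_Icc_eq_integral_Ioc, ← intervalIntegral.integral_of_le hF.le]
    have h1 : ∀ y : ℝ, (u - u * (y / F)) ^ d = (fun t => t ^ d) (u - (u / F) * y) := by
      intro y
      ring
    simp_rw [h1]
    rw [intervalIntegral.integral_comp_sub_mul (fun t => t ^ d) (by positivity), integral_pow,
      smul_eq_mul, div_mul_cancel₀ _ hF.ne', sub_self, mul_zero, sub_zero,
      zero_pow d.succ_ne_zero, sub_zero]
    field_simp
    ring
  · refine (ae_restrict_iff' measurableSet_Icc).2 (ae_of_all _ fun y hy => pow_nonneg ?_ _)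
    have : y / F ≤ 1 := (div_le_one hF).2 hy.2
    nlinarith

theorem volume_pyramid_le {d : ℕ} (hd : 1 ≤ d) (v : Fin d → ℝ) {u F r : ℝ} (hu : 0 < u)
    (hF : 0 < F) (hr : 0 ≤ r) :
    volume (pyramid v u F r) ≤ ENNReal.ofReal (F * u ^ d / ((d : ℝ) + 1) + r * u ^ d) := by
  -- Lowering by `r` maps the part above height `r` into the original pyramid; the rest is in a slab
  -- of thickness `r`.
  have hsub : pyramid v u F r ⊆
      (fun p => p + ((0, -r) : (Fin d → ℝ) × ℝ)) ⁻¹' pyramid v u F 0 ∪ box v u ×ˢ Icc 0 r := by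
    rintro ⟨x, y⟩ ⟨h1, h2, h3⟩
    rcases le_or_gt y r with h | h
    · exact Or.inr ⟨h1, h2, h⟩
    · refine Or.inl ⟨by simpa using h1, ?_, fun j => ?_⟩
      · simpa using h.le
      · have := h3 j
        simp only [Prod.mk_add_mk, add_zero]
        simp only at this
        linarith
  refine (measure_mono hsub).trans ((measure_union_le _ _).trans ?_)
  have : (volume : Measure ((Fin d → ℝ) × ℝ)).IsAddHaarMeasure :=
    Measure.prod.instIsAddHaarMeasure volume volume
  rw [measure_preimage_add_right, volume_pyramid hd v hu hF, Measure.volume_eq_prod,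
    Measure.prod_prod, volume_box v hu, Real.volume_Icc, sub_zero,
    ← ENNReal.ofReal_mul (by positivity), ← ENNReal.ofReal_add (by positivity) (by positivity),
    mul_comm r]

/-! ### The top corner and the concave envelope -/

theorem expFun_corner {d : ℕ} (c v : Fin d → ℝ) (u : ℝ) :
    expFun c (v + u • (1 : Fin d → ℝ)) =
      Real.exp (c ⬝ᵥ v) * Real.exp (u * (c ⬝ᵥ (1 : Fin d → ℝ))) - 1 := by
  rw [expFun, dotProduct_add, dotProduct_smul, Real.exp_add, smul_eq_mul]

theorem isGreatest_expFun_corner {d : ℕ} {c : Fin d → ℝ} (hc : ∀ j, 0 < c j) (v : Fin d → ℝ)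
    {u : ℝ} (hu : 0 < u) :
    IsGreatest (expFun c '' box v u) (expFun c (v + u • (1 : Fin d → ℝ))) := by
  rw [box_eq_Icc v hu]
  refine ⟨⟨_, ⟨fun j => by simp [hu.le], le_rfl⟩, rfl⟩, ?_⟩
  rintro _ ⟨x, hx, rfl⟩
  exact sub_le_sub_right (Real.exp_le_exp.2
    (dotProduct_le_dotProduct_of_nonneg_left hx.2 fun j => (hc j).le)) 1

theorem maxOn_expFun_box {d : ℕ} {c : Fin d → ℝ} (hc : ∀ j, 0 < c j) (v : Fin d → ℝ)
    {u : ℝ} (hu : 0 < u) :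
    maxOn (expFun c) (box v u) = expFun c (v + u • (1 : Fin d → ℝ)) :=
  (isGreatest_expFun_corner hc v hu).csSup_eq

theorem dotProduct_corner_pos {d : ℕ} (hd : 1 ≤ d) {c v : Fin d → ℝ} (hc : ∀ j, 0 < c j)
    (hv : ∀ j, 0 < v j) {u : ℝ} (hu : 0 < u) : 0 < c ⬝ᵥ (v + u • (1 : Fin d → ℝ)) := by
  have : Nonempty (Fin d) := ⟨⟨0, hd⟩⟩
  refine Finset.sum_pos (fun j _ => mul_pos (hc j) ?_) Finset.univ_nonempty
  simpa using add_pos (hv j) hu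

theorem concEnv_expFun_isConcaveUpperBound {d : ℕ} {c : Fin d → ℝ} (hc : ∀ j, 0 < c j)
    (v : Fin d → ℝ) {u : ℝ} (hu : 0 < u) :
    IsConcaveUpperBound (expFun c) (box v u) (concEnv (expFun c) (box v u)) :=
  concEnv_isConcaveUpperBound (convex_box v hu) (isGreatest_expFun_corner hc v hu).bddAbove

theorem maxOn_isConcaveUpperBound {d : ℕ} {c : Fin d → ℝ} (hc : ∀ j, 0 < c j)
    (v : Fin d → ℝ) {u : ℝ} (hu : 0 < u) :
    IsConcaveUpperBound (expFun c) (box v u) (fun _ => maxOn (expFun c) (box v u)) := by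
  refine ⟨concaveOn_const _ (convex_box v hu), fun x hx => ?_⟩
  rw [maxOn_expFun_box hc v hu]
  exact (isGreatest_expFun_corner hc v hu).2 ⟨x, hx, rfl⟩

/-- On the box, `f` lies below the affine function that interpolates in the direction `j` between
the values of `f` at two vertices. -/
theorem expFun_le_affine {d : ℕ} {c : Fin d → ℝ} (hc : ∀ j, 0 < c j) {v : Fin d → ℝ} {u : ℝ}
    (hu : 0 < u) {x : Fin d → ℝ} (hx : x ∈ box v u) (j : Fin d) :
    expFun c x ≤ Real.exp (c ⬝ᵥ (v + u • (1 : Fin d → ℝ)) - u * c j) +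
      expFun c (v + u • (1 : Fin d → ℝ)) * ((x j - v j) / u) := by
  rw [box_eq_Icc v hu] at hx
  set k := c ⬝ᵥ (v + u • (1 : Fin d → ℝ)) with hk
  set t := (x j - v j) / u with ht
  have hxj : x j = v j + u * t := by
    rw [ht]
    field_simp
    ring
  have ht0 : 0 ≤ t := div_nonneg (sub_nonneg.2 (hx.1 j)) hu.le
  have ht1 : t ≤ 1 := by
    have := hx.2 j
    simp only [Pi.add_apply, Pi.smul_apply, Pi.one_apply, smul_eq_mul, mul_one] at this
    exact (div_le_one hu).2 (by linarith)
  -- The right side equals `k - c j * (v j + u - x j)`: all coordinates other than `j` are moved up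
  -- to the top corner.
  have hdot : c ⬝ᵥ x ≤ (1 - t) * (k - u * c j) + t * k := by
    have h1 : k - c ⬝ᵥ x = c ⬝ᵥ (v + u • (1 : Fin d → ℝ) - x) := by
      rw [dotProduct_sub]
    have h2 : c j * (v j + u - x j) ≤ c ⬝ᵥ (v + u • (1 : Fin d → ℝ) - x) := by
      have := Finset.single_le_sum (f := fun i => c i * (v + u • (1 : Fin d → ℝ) - x) i)
        (fun i _ => mul_nonneg (hc i).le (sub_nonneg.2 (hx.2 i))) (Finset.mem_univ j)
      simpa [dotProduct] using this
    rw [hxj] at h2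
    nlinarith
  have hcv := convexOn_exp.2 (mem_univ (k - u * c j)) (mem_univ k) (sub_nonneg.2 ht1) ht0
    (sub_add_cancel 1 t)
  simp only [smul_eq_mul] at hcv
  have h3 := (Real.exp_le_exp.2 hdot).trans hcv
  simp only [expFun, ← hk]
  nlinarith [Real.exp_pos (k - u * c j)]

/-- For each `j` the affine bound is a concave upper bound, so it dominates the envelope. Summing
the vertex terms gives one offset valid for every `j`. -/
theorem band_concEnv_subset_pyramid {d : ℕ} {c : Fin d → ℝ} (hc : ∀ j, 0 < c j)
    (v : Fin d → ℝ) {u : ℝ} (hu : 0 < u) :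
    band 0 (concEnv (expFun c) (box v u)) (box v u) ⊆
      pyramid v u (expFun c (v + u • (1 : Fin d → ℝ)))
        (∑ j, Real.exp (c ⬝ᵥ (v + u • (1 : Fin d → ℝ)) - u * c j)) := by
  rintro ⟨x, y⟩ ⟨h1, h2, h3⟩
  refine ⟨h1, h2, fun j => h3.trans ?_⟩
  refine concEnv_le (g := fun x => (∑ j, Real.exp (c ⬝ᵥ (v + u • (1 : Fin d → ℝ)) - u * c j)) +
    expFun c (v + u • (1 : Fin d → ℝ)) * ((x j - v j) / u)) ⟨⟨convex_box v hu, ?_⟩, ?_⟩ h1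
  · intro x _ y _ a b _ _ hab
    simp only [smul_eq_mul, Pi.add_apply, Pi.smul_apply]
    have hb : b = 1 - a := by linarith
    subst hb
    apply le_of_eq
    ring
  · intro x hx
    refine (expFun_le_affine hc hu hx j).trans (add_le_add_left ?_ _)
    exact Finset.single_le_sum
      (f := fun j => Real.exp (c ⬝ᵥ (v + u • (1 : Fin d → ℝ)) - u * c j))
      (fun i _ => (Real.exp_pos _).le) (Finset.mem_univ j)

/-- A concave function that is nonnegative on the box and at least `F` at the top corner lies above
the pyramid with that apex. -/
theorem pyramid_subset_band_concEnv {d : ℕ} (hd : 1 ≤ d) {c v : Fin d → ℝ} (hc : ∀ j, 0 < c j)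
    (hv : ∀ j, 0 < v j) {u : ℝ} (hu : 0 < u)
    (hF : 0 < expFun c (v + u • (1 : Fin d → ℝ))) :
    pyramid v u (expFun c (v + u • (1 : Fin d → ℝ))) 0 ⊆
      band 0 (concEnv (expFun c) (box v u)) (box v u) := by
  rintro ⟨x, y⟩ ⟨h1, h2, h3⟩
  refine ⟨h1, h2, ?_⟩
  simp only [zero_add] at h1 h2 h3 ⊢
  set F := expFun c (v + u • (1 : Fin d → ℝ)) with hFdef
  have hcon := concEnv_expFun_isConcaveUpperBound hc v hu
  set m := y / F with hm
  have hyF : y = m * F := by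
    rw [hm]
    field_simp
  have hxu : ∀ j, x j ≤ v j + u := by
    intro j
    have h1' := h1
    rw [box_eq_Icc v hu] at h1'
    simpa using h1'.2 j
  have hmx : ∀ j, v j + u * m ≤ x j := by
    intro j
    have h := h3 j
    rw [hyF, mul_comm m F] at h
    have h' := le_of_mul_le_mul_left h hF
    rw [le_div_iff₀ hu] at h'
    linarith
  have hm0 : 0 ≤ m := div_nonneg h2 hF.le
  have hm1 : m ≤ 1 := by
    have a1 := hxu ⟨0, hd⟩
    have a2 := hmx ⟨0, hd⟩
    by_contra! hcon
    nlinarith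
  have hcorner : v + u • (1 : Fin d → ℝ) ∈ box v u := by
    rw [box_eq_Icc v hu]
    exact ⟨fun j => by simp [hu.le], le_rfl⟩
  rcases hm1.eq_or_lt with hm1 | hm1
  · have : x = v + u • (1 : Fin d → ℝ) := by
      ext j
      have := hmx j
      rw [hm1] at this
      simp only [Pi.add_apply, Pi.smul_apply, Pi.one_apply, smul_eq_mul, mul_one]
      linarith [hxu j]
    rw [hyF, hm1, one_mul, this, hFdef]
    exact hcon.2 _ hcorner
  · have hpos : 0 < 1 - m := sub_pos.2 hm1
    -- Solves `x = m • corner + (1 - m) • s`, with `m = y / F`; the pyramid inequalities say exactly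
    -- that `s` stays above the lower facets.
    set s : Fin d → ℝ := (1 - m)⁻¹ • (x - m • (v + u • (1 : Fin d → ℝ))) with hs
    have hsQ : s ∈ box v u := by
      rw [box_eq_Icc v hu]
      constructor <;> intro j <;> simp only [hs, Pi.add_apply, Pi.smul_apply, Pi.one_apply,
        Pi.sub_apply, smul_eq_mul, mul_one]
      · rw [le_inv_mul_iff₀ hpos]
        linarith [hmx j]
      · rw [inv_mul_le_iff₀ hpos]
        linarith [hxu j]
    have hx : x = m • (v + u • (1 : Fin d → ℝ)) + (1 - m) • s := by
      rw [hs, smul_inv_smul₀ hpos.ne']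
      simp
    have h := hcon.1.2 hcorner hsQ hm0 hpos.le (add_sub_cancel _ _)
    rw [← hx] at h
    refine le_trans ?_ h
    have e1 : F ≤ concEnv (expFun c) (box v u) (v + u • (1 : Fin d → ℝ)) := hcon.2 _ hcorner
    have e2 : 0 ≤ concEnv (expFun c) (box v u) s :=
      (expFun_nonneg hc (nonneg_of_mem_box hv hu hsQ)).trans (hcon.2 _ hsQ)
    rw [hyF, smul_eq_mul, smul_eq_mul]
    nlinarith [mul_le_mul_of_nonneg_left e1 hm0, mul_nonneg hpos.le e2]

/-! ### Volumes and cut-off amount for the exponential -/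

theorem band_subset_band_zero {d : ℕ} {f μ : (Fin d → ℝ) → ℝ} {Q : Set (Fin d → ℝ)}
    (hf : ∀ x ∈ Q, 0 ≤ f x) : band f μ Q ⊆ band 0 μ Q :=
  fun _ hp => ⟨hp.1, (hf _ hp.1).trans hp.2.1, hp.2.2⟩

theorem cutOff_expFun_box {d : ℕ} {c v : Fin d → ℝ} (hc : ∀ j, 0 < c j) (hv : ∀ j, 0 < v j)
    {u : ℝ} (hu : 0 < u) {μ : (Fin d → ℝ) → ℝ} (hμ : IsConcaveUpperBound (expFun c) (box v u) μ)
    (hfin : volume (truncCone (band 0 μ (box v u))) ≠ ⊤) :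
    cutOff (expFun c) (box v u) μ = (∫ x in box v u, expFun c x) / ((d : ℝ) + 2) -
        volume.real (underNaive (expFun c) (box v u)) ∧
      vol (naiveRelaxation (expFun c) (box v u) μ) =
        volume.real (truncCone (band 0 μ (box v u))) -
          volume.real (underNaive (expFun c) (box v u)) := by
  have h0 : ∀ x ∈ box v u, 0 ≤ expFun c x :=
    fun x hx => expFun_nonneg hc (nonneg_of_mem_box hv hu hx)
  have hpos : ∀ x ∈ box v u, ∀ z : ℝ, 0 < z → z ≤ 1 →
      0 ≤ expFun c (z • x) ∧ expFun c (z • x) ≤ z * expFun c x :=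
    fun x hx z hz hz1 => expFun_smul_bounds hc (nonneg_of_mem_box hv hu hx) hz hz1
  have hvolU := volume_under_expFun_box hc hv hu
  have hU := measurableSet_under (continuous_expFun c).measurable (measurableSet_box v hu)
  have hN := measurableSet_underNaive (continuous_expFun c).measurable (measurableSet_box v hu)
  have hUfin : volume (under (expFun c) (box v u)) ≠ ⊤ := by
    rw [hvolU]
    exact ENNReal.ofReal_ne_top
  have hB := measure_ne_top_of_subset (truncCone_mono (band_subset_band_zero (μ := μ) h0)) hfin
  refine ⟨?_, vol_naiveRelaxation_eq hμ hpos hU hUfin hN hB⟩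
  rw [cutOff_eq ((convexOn_expFun c).subset (subset_univ _) (convex_box v hu)) hμ hpos hU hUfin hN
    hB, Measure.real, hvolU, ENNReal.toReal_ofReal]
  exact setIntegral_nonneg (measurableSet_box v hu) h0

theorem real_volume_underNaive_le {d : ℕ} (hd : 1 ≤ d) {c v : Fin d → ℝ} (hc : ∀ j, 0 < c j)
    (hv : ∀ j, 0 < v j) {u : ℝ} (hu : 0 < u) :
    volume.real (underNaive (expFun c) (box v u)) ≤
      Real.exp (c ⬝ᵥ (v + u • (1 : Fin d → ℝ))) /
        (c ⬝ᵥ (v + u • (1 : Fin d → ℝ)) * ∏ j, c j) := by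
  have hk := dotProduct_corner_pos hd hc hv hu
  refine ENNReal.toReal_le_of_le_ofReal ?_ (volume_underNaive_le hc hv hu hk rfl)
  have : 0 < ∏ j, c j := Finset.prod_pos fun j _ => hc j
  positivity

theorem volume_band_zero_const {d : ℕ} (v : Fin d → ℝ) {u : ℝ} (hu : 0 < u) (F : ℝ) :
    MeasurableSet (band 0 (fun _ => F) (box v u)) ∧
      volume (band 0 (fun _ => F) (box v u)) = ENNReal.ofReal (u ^ d) * ENNReal.ofReal F := by
  have : band 0 (fun _ => F) (box v u) = box v u ×ˢ Icc 0 F := rfl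
  rw [this, Measure.volume_eq_prod, Measure.prod_prod, volume_box v hu, Real.volume_Icc, sub_zero]
  exact ⟨(measurableSet_box v hu).prod measurableSet_Icc, rfl⟩

theorem vol_naiveRelaxation_maxOn {d : ℕ} (hd : 1 ≤ d) {c v : Fin d → ℝ} (hc : ∀ j, 0 < c j)
    (hv : ∀ j, 0 < v j) {u : ℝ} (hu : 0 < u) :
    cutOff (expFun c) (box v u) (fun _ => maxOn (expFun c) (box v u)) =
        (∫ x in box v u, expFun c x) / ((d : ℝ) + 2) -
          volume.real (underNaive (expFun c) (box v u)) ∧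
      vol (naiveRelaxation (expFun c) (box v u) (fun _ => maxOn (expFun c) (box v u))) =
        expFun c (v + u • (1 : Fin d → ℝ)) * u ^ d / ((d : ℝ) + 2) -
          volume.real (underNaive (expFun c) (box v u)) := by
  have hF : 0 < expFun c (v + u • (1 : Fin d → ℝ)) :=
    sub_pos.2 (Real.one_lt_exp_iff.2 (dotProduct_corner_pos hd hc hv hu))
  have hb := volume_band_zero_const v hu (maxOn (expFun c) (box v u))
  have h := cutOff_expFun_box hc hv hu (maxOn_isConcaveUpperBound hc v hu)
    (volume_truncCone_ne_top hb.1 (by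
      rw [hb.2]
      exact ENNReal.mul_ne_top ENNReal.ofReal_ne_top ENNReal.ofReal_ne_top))
  refine ⟨h.1, h.2.trans ?_⟩
  rw [real_volume_truncCone hb.1, Measure.real, hb.2, maxOn_expFun_box hc v hu,
    ENNReal.toReal_mul, ENNReal.toReal_ofReal (by positivity), ENNReal.toReal_ofReal hF.le,
    mul_comm]

theorem vol_naiveRelaxation_concEnv {d : ℕ} (hd : 1 ≤ d) {c v : Fin d → ℝ} (hc : ∀ j, 0 < c j)
    (hv : ∀ j, 0 < v j) {u : ℝ} (hu : 0 < u) :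
    cutOff (expFun c) (box v u) (concEnv (expFun c) (box v u)) =
        (∫ x in box v u, expFun c x) / ((d : ℝ) + 2) -
          volume.real (underNaive (expFun c) (box v u)) ∧
      expFun c (v + u • (1 : Fin d → ℝ)) * u ^ d / ((d : ℝ) + 1) / ((d : ℝ) + 2) -
          volume.real (underNaive (expFun c) (box v u)) ≤
        vol (naiveRelaxation (expFun c) (box v u) (concEnv (expFun c) (box v u))) ∧
      vol (naiveRelaxation (expFun c) (box v u) (concEnv (expFun c) (box v u))) ≤
        (expFun c (v + u • (1 : Fin d → ℝ)) * u ^ d / ((d : ℝ) + 1) +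
          (∑ j, Real.exp (c ⬝ᵥ (v + u • (1 : Fin d → ℝ)) - u * c j)) * u ^ d) / ((d : ℝ) + 2) -
          volume.real (underNaive (expFun c) (box v u)) := by
  have hF : 0 < expFun c (v + u • (1 : Fin d → ℝ)) :=
    sub_pos.2 (Real.one_lt_exp_iff.2 (dotProduct_corner_pos hd hc hv hu))
  have hr : 0 ≤ ∑ j, Real.exp (c ⬝ᵥ (v + u • (1 : Fin d → ℝ)) - u * c j) :=
    Finset.sum_nonneg fun j _ => (Real.exp_pos _).le
  have hP := measurableSet_pyramid v hu (expFun c (v + u • (1 : Fin d → ℝ))) 0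
  have hP' := measurableSet_pyramid v hu (expFun c (v + u • (1 : Fin d → ℝ)))
    (∑ j, Real.exp (c ⬝ᵥ (v + u • (1 : Fin d → ℝ)) - u * c j))
  have hvol := volume_pyramid hd v hu hF
  have hvol' := volume_pyramid_le hd v hu hF hr
  have hlow := truncCone_mono (pyramid_subset_band_concEnv hd hc hv hu hF)
  have hup := truncCone_mono (band_concEnv_subset_pyramid hc v hu)
  have hfin' := volume_truncCone_ne_top hP' (ne_top_of_le_ne_top ENNReal.ofReal_ne_top hvol')
  have hfin := measure_ne_top_of_subset hup hfin'
  have h := cutOff_expFun_box hc hv hu (concEnv_expFun_isConcaveUpperBound hc v hu) hfin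
  refine ⟨h.1, ?_, ?_⟩
  · rw [h.2]
    refine sub_le_sub_right ?_ _
    refine le_trans (le_of_eq ?_) (measureReal_mono hlow hfin)
    rw [real_volume_truncCone hP, Measure.real, hvol, ENNReal.toReal_ofReal (by positivity)]
  · rw [h.2]
    refine sub_le_sub_right ((measureReal_mono hup hfin').trans ?_) _
    rw [real_volume_truncCone hP']
    refine div_le_div_of_nonneg_right ?_ (by positivity)
    exact ENNReal.toReal_le_of_le_ofReal (by positivity) hvol'

/-! ### Asymptotics relative to `e^k` -/

theorem dotProduct_corner {d : ℕ} (c v : Fin d → ℝ) (u : ℝ) :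
    c ⬝ᵥ (v + u • (1 : Fin d → ℝ)) = c ⬝ᵥ v + u * ∑ j, c j := by
  rw [dotProduct_add, dotProduct_smul, smul_eq_mul, dotProduct_one]

theorem tendsto_dotProduct_corner {d : ℕ} (hd : 1 ≤ d) {c : Fin d → ℝ} (hc : ∀ j, 0 < c j)
    (v : Fin d → ℝ) :
    Tendsto (fun u : ℝ => c ⬝ᵥ (v + u • (1 : Fin d → ℝ))) atTop atTop := by
  have : Nonempty (Fin d) := ⟨⟨0, hd⟩⟩
  simp_rw [dotProduct_corner]
  exact tendsto_atTop_add_const_left _ _ (tendsto_id.atTop_mul_const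
    (Finset.sum_pos (fun j _ => hc j) Finset.univ_nonempty))

theorem tendsto_pow_div_exp_corner {d : ℕ} (hd : 1 ≤ d) {c : Fin d → ℝ} (hc : ∀ j, 0 < c j)
    (v : Fin d → ℝ) :
    Tendsto (fun u : ℝ => u ^ d / Real.exp (c ⬝ᵥ (v + u • (1 : Fin d → ℝ)))) atTop (𝓝 0) := by
  have : Nonempty (Fin d) := ⟨⟨0, hd⟩⟩
  have hC : 0 < ∑ j, c j := Finset.sum_pos (fun j _ => hc j) Finset.univ_nonempty
  have h := (tendsto_rpow_mul_exp_neg_mul_atTop_nhds_zero (d : ℝ) _ hC).mul_const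
    (Real.exp (-(c ⬝ᵥ v)))
  rw [zero_mul] at h
  refine h.congr fun u => ?_
  rw [dotProduct_corner, Real.rpow_natCast, mul_assoc, ← Real.exp_add, div_eq_mul_inv,
    ← Real.exp_neg]
  congr 2
  ring

theorem tendsto_exp_neg_mul {a : ℝ} (ha : 0 < a) :
    Tendsto (fun u : ℝ => Real.exp (-(u * a))) atTop (𝓝 0) :=
  Real.tendsto_exp_neg_atTop_nhds_zero.comp (tendsto_id.atTop_mul_const ha)

/-- After division by `e^k` the factors become `(1 - e^(-u c_j)) / c_j`, and the subtracted `u^d`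
vanishes. -/
theorem tendsto_integral_expFun_div_exp_corner {d : ℕ} (hd : 1 ≤ d) {c : Fin d → ℝ}
    (hc : ∀ j, 0 < c j) (v : Fin d → ℝ) :
    Tendsto (fun u : ℝ => (∫ x in box v u, expFun c x) /
      Real.exp (c ⬝ᵥ (v + u • (1 : Fin d → ℝ)))) atTop (𝓝 (1 / ∏ j, c j)) := by
  have h1 : Tendsto (fun u : ℝ => ∏ j, (1 - Real.exp (-(u * c j))) / c j) atTop
      (𝓝 (∏ j, (1 - 0) / c j)) :=
    tendsto_finsetProd _ fun j _ => ((tendsto_exp_neg_mul (hc j)).const_sub 1).div_const _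
  have h2 := h1.sub (tendsto_pow_div_exp_corner hd hc v)
  have e : (∏ j, (1 - 0) / c j) - 0 = 1 / ∏ j, c j := by
    simp [Finset.prod_inv_distrib]
  rw [e] at h2
  refine h2.congr' ?_
  filter_upwards [eventually_gt_atTop 0] with u hu
  rw [integral_expFun_box hc hu, sub_div]
  congr 1
  rw [dotProduct, Real.exp_sum, ← Finset.prod_div_distrib]
  refine Finset.prod_congr rfl fun j _ => ?_
  have hexp : Real.exp (c j * v j) = Real.exp (c j * (v j + u)) * Real.exp (-(u * c j)) := by
    rw [← Real.exp_add]
    congr 1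
    ring
  simp only [Pi.add_apply, Pi.smul_apply, Pi.one_apply, smul_eq_mul, mul_one]
  rw [hexp]
  have := (hc j).ne'
  field_simp

theorem tendsto_volume_underNaive_div_exp_corner {d : ℕ} (hd : 1 ≤ d) {c v : Fin d → ℝ}
    (hc : ∀ j, 0 < c j) (hv : ∀ j, 0 < v j) :
    Tendsto (fun u : ℝ => volume.real (underNaive (expFun c) (box v u)) /
      Real.exp (c ⬝ᵥ (v + u • (1 : Fin d → ℝ)))) atTop (𝓝 0) := by
  have hcp : 0 < ∏ j, c j := Finset.prod_pos fun j _ => hc j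
  refine squeeze_zero' (Eventually.of_forall fun u => by positivity) ?_
    ((tendsto_dotProduct_corner hd hc v).atTop_mul_const hcp).inv_tendsto_atTop
  filter_upwards [eventually_gt_atTop 0] with u hu
  rw [div_le_iff₀ (Real.exp_pos _)]
  refine (real_volume_underNaive_le hd hc hv hu).trans (le_of_eq ?_)
  rw [Pi.inv_apply, inv_mul_eq_div]

theorem tendsto_expFun_corner_div_exp {d : ℕ} (hd : 1 ≤ d) {c : Fin d → ℝ} (hc : ∀ j, 0 < c j)
    (v : Fin d → ℝ) :
    Tendsto (fun u : ℝ => expFun c (v + u • (1 : Fin d → ℝ)) /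
      Real.exp (c ⬝ᵥ (v + u • (1 : Fin d → ℝ)))) atTop (𝓝 1) := by
  have h := ((Real.tendsto_exp_neg_atTop_nhds_zero.comp
    (tendsto_dotProduct_corner hd hc v)).const_sub 1)
  rw [sub_zero] at h
  refine h.congr fun u => ?_
  simp [expFun, sub_div, Real.exp_neg]

theorem tendsto_sum_exp_facets_div_exp {d : ℕ} {c : Fin d → ℝ} (hc : ∀ j, 0 < c j)
    (v : Fin d → ℝ) :
    Tendsto (fun u : ℝ => (∑ j, Real.exp (c ⬝ᵥ (v + u • (1 : Fin d → ℝ)) - u * c j)) /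
      Real.exp (c ⬝ᵥ (v + u • (1 : Fin d → ℝ)))) atTop (𝓝 0) := by
  have h : Tendsto (fun u : ℝ => ∑ j, Real.exp (-(u * c j))) atTop (𝓝 (∑ _j : Fin d, (0 : ℝ))) :=
    tendsto_finsetSum _ fun j _ => tendsto_exp_neg_mul (hc j)
  rw [Finset.sum_const_zero] at h
  refine h.congr fun u => ?_
  rw [Finset.sum_div]
  refine Finset.sum_congr rfl fun j _ => ?_
  rw [← Real.exp_sub]
  congr 1
  ring

theorem tendsto_inv_pow_atTop {d : ℕ} (hd : 1 ≤ d) :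
    Tendsto (fun u : ℝ => (u ^ d)⁻¹) atTop (𝓝 0) :=
  (tendsto_pow_atTop (by omega)).inv_tendsto_atTop

/-- If the cut-off amount is of order `A e` and the volume of order `B e u^d`, then the cut-off
ratio is of order `(A / B) u^{-d}`. -/
theorem tendsto_pow_mul_div {d : ℕ} {D V e : ℝ → ℝ} (he : ∀ u, 0 < e u) {A B : ℝ} (hB : B ≠ 0)
    (hD : Tendsto (fun u => D u / e u) atTop (𝓝 A))
    (hV : Tendsto (fun u => V u / (e u * u ^ d)) atTop (𝓝 B)) :
    Tendsto (fun u => u ^ d * (D u / V u)) atTop (𝓝 (A / B)) := by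
  refine (hD.div hV hB).congr' ?_
  filter_upwards [eventually_gt_atTop 0] with u hu
  have := (he u).ne'
  simp only [Pi.div_apply]
  field_simp

theorem tendsto_zero_of_tendsto_pow_mul {d : ℕ} (hd : 1 ≤ d) {r : ℝ → ℝ} {A : ℝ}
    (h : Tendsto (fun u => u ^ d * r u) atTop (𝓝 A)) : Tendsto r atTop (𝓝 0) := by
  have h' := h.mul (tendsto_inv_pow_atTop hd)
  rw [mul_zero] at h'
  refine h'.congr' ?_
  filter_upwards [eventually_gt_atTop 0] with u hu
  field_simp

theorem tendsto_cutOff_div_exp_corner {d : ℕ} (hd : 1 ≤ d) {c v : Fin d → ℝ}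
    (hc : ∀ j, 0 < c j) (hv : ∀ j, 0 < v j) :
    Tendsto (fun u : ℝ => cutOff (expFun c) (box v u) (fun _ => maxOn (expFun c) (box v u)) /
      Real.exp (c ⬝ᵥ (v + u • (1 : Fin d → ℝ)))) atTop
      (𝓝 (1 / (∏ j, c j) / ((d : ℝ) + 2))) := by
  have h := ((tendsto_integral_expFun_div_exp_corner hd hc v).div_const ((d : ℝ) + 2)).sub
    (tendsto_volume_underNaive_div_exp_corner hd hc hv)
  rw [sub_zero] at h
  refine h.congr' ?_
  filter_upwards [eventually_gt_atTop 0] with u hu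
  rw [(vol_naiveRelaxation_maxOn hd hc hv hu).1]
  ring

theorem tendsto_vol_naiveRelaxation_maxOn {d : ℕ} (hd : 1 ≤ d) {c v : Fin d → ℝ}
    (hc : ∀ j, 0 < c j) (hv : ∀ j, 0 < v j) :
    Tendsto (fun u : ℝ =>
      vol (naiveRelaxation (expFun c) (box v u) (fun _ => maxOn (expFun c) (box v u))) /
      (Real.exp (c ⬝ᵥ (v + u • (1 : Fin d → ℝ))) * u ^ d)) atTop
      (𝓝 (1 / ((d : ℝ) + 2))) := by
  have h := ((tendsto_expFun_corner_div_exp hd hc v).div_const ((d : ℝ) + 2)).sub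
    ((tendsto_volume_underNaive_div_exp_corner hd hc hv).mul (tendsto_inv_pow_atTop hd))
  rw [mul_zero, sub_zero] at h
  refine h.congr' ?_
  filter_upwards [eventually_gt_atTop 0] with u hu
  rw [(vol_naiveRelaxation_maxOn hd hc hv hu).2]
  field_simp

/-- Squeezed between the two pyramids, whose offset is `o(e^k)`. -/
theorem tendsto_vol_naiveRelaxation_concEnv {d : ℕ} (hd : 1 ≤ d) {c v : Fin d → ℝ}
    (hc : ∀ j, 0 < c j) (hv : ∀ j, 0 < v j) :
    Tendsto (fun u : ℝ =>
      vol (naiveRelaxation (expFun c) (box v u) (concEnv (expFun c) (box v u))) /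
      (Real.exp (c ⬝ᵥ (v + u • (1 : Fin d → ℝ))) * u ^ d)) atTop
      (𝓝 (1 / ((d : ℝ) + 1) / ((d : ℝ) + 2))) := by
  have hn := (tendsto_volume_underNaive_div_exp_corner hd hc hv).mul (tendsto_inv_pow_atTop hd)
  have hF := (tendsto_expFun_corner_div_exp hd hc v).div_const ((d : ℝ) + 1)
  have hlow := (hF.div_const ((d : ℝ) + 2)).sub hn
  have hup := ((hF.add (tendsto_sum_exp_facets_div_exp hc v)).div_const ((d : ℝ) + 2)).sub hn
  rw [mul_zero, sub_zero] at hlow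
  rw [mul_zero, sub_zero, add_zero] at hup
  refine tendsto_of_tendsto_of_tendsto_of_le_of_le' hlow hup ?_ ?_
  · filter_upwards [eventually_gt_atTop 0] with u hu
    rw [le_div_iff₀ (by positivity)]
    refine le_trans (le_of_eq ?_) (vol_naiveRelaxation_concEnv hd hc hv hu).2.1
    field_simp
  · filter_upwards [eventually_gt_atTop 0] with u hu
    rw [div_le_iff₀ (by positivity)]
    refine (vol_naiveRelaxation_concEnv hd hc hv hu).2.2.trans (le_of_eq ?_)
    field_simp

theorem cutOff_concEnv_eq_cutOff_maxOn {d : ℕ} (hd : 1 ≤ d) {c v : Fin d → ℝ}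
    (hc : ∀ j, 0 < c j) (hv : ∀ j, 0 < v j) {u : ℝ} (hu : 0 < u) :
    cutOff (expFun c) (box v u) (concEnv (expFun c) (box v u)) =
      cutOff (expFun c) (box v u) (fun _ => maxOn (expFun c) (box v u)) := by
  rw [(vol_naiveRelaxation_concEnv hd hc hv hu).1, (vol_naiveRelaxation_maxOn hd hc hv hu).1]

theorem tendsto_pow_mul_cutOffRatio_concEnv {d : ℕ} (hd : 1 ≤ d) {c v : Fin d → ℝ}
    (hc : ∀ j, 0 < c j) (hv : ∀ j, 0 < v j) :
    Tendsto (fun u : ℝ => u ^ d *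
      cutOffRatio (expFun c) (box v u) (concEnv (expFun c) (box v u))) atTop
      (𝓝 (((d : ℝ) + 1) / ∏ j, c j)) := by
  have h := tendsto_pow_mul_div (fun u => Real.exp_pos (c ⬝ᵥ (v + u • (1 : Fin d → ℝ))))
    (by positivity) (tendsto_cutOff_div_exp_corner hd hc hv)
    (tendsto_vol_naiveRelaxation_concEnv hd hc hv)
  have e : 1 / (∏ j, c j) / ((d : ℝ) + 2) / (1 / ((d : ℝ) + 1) / ((d : ℝ) + 2)) =
      ((d : ℝ) + 1) / ∏ j, c j := by
    field_simp
  rw [e] at h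
  refine h.congr' ?_
  filter_upwards [eventually_gt_atTop 0] with u hu
  rw [cutOffRatio, cutOff_concEnv_eq_cutOff_maxOn hd hc hv hu]

theorem tendsto_pow_mul_cutOffRatio_maxOn {d : ℕ} (hd : 1 ≤ d) {c v : Fin d → ℝ}
    (hc : ∀ j, 0 < c j) (hv : ∀ j, 0 < v j) :
    Tendsto (fun u : ℝ => u ^ d *
      cutOffRatio (expFun c) (box v u) (fun _ => maxOn (expFun c) (box v u))) atTop
      (𝓝 (1 / ∏ j, c j)) := by
  have h := tendsto_pow_mul_div (fun u => Real.exp_pos (c ⬝ᵥ (v + u • (1 : Fin d → ℝ))))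
    (by positivity) (tendsto_cutOff_div_exp_corner hd hc hv)
    (tendsto_vol_naiveRelaxation_maxOn hd hc hv)
  have e : 1 / (∏ j, c j) / ((d : ℝ) + 2) / (1 / ((d : ℝ) + 2)) = 1 / ∏ j, c j := by
    field_simp
  rwa [e] at h

end BoxRelax

theorem mainTheorem1 (d : ℕ) (hd : 1 ≤ d) (c v₀ : Fin d → ℝ)
    (hc : ∀ j, 0 < c j) (hv₀ : ∀ j, 0 < v₀ j) :
    -- the constant bound `F` is a maximum, and its explicit value
    (∀ u : ℝ, 0 < u →
      IsGreatest (BoxRelax.expFun c '' BoxRelax.box v₀ u)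
        (BoxRelax.maxOn (BoxRelax.expFun c) (BoxRelax.box v₀ u)) ∧
      BoxRelax.maxOn (BoxRelax.expFun c) (BoxRelax.box v₀ u) =
        BoxRelax.expFun c (v₀ + u • (1 : Fin d → ℝ)) ∧
      BoxRelax.maxOn (BoxRelax.expFun c) (BoxRelax.box v₀ u) =
        Real.exp (c ⬝ᵥ v₀) * Real.exp (u * (c ⬝ᵥ (1 : Fin d → ℝ))) - 1) ∧
    -- the cut-off amount is the same for both upper bounds
    (∀ u : ℝ, 0 < u →
      BoxRelax.cutOff (BoxRelax.expFun c) (BoxRelax.box v₀ u)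
        (BoxRelax.concEnv (BoxRelax.expFun c) (BoxRelax.box v₀ u)) =
      BoxRelax.cutOff (BoxRelax.expFun c) (BoxRelax.box v₀ u)
        (fun _ => BoxRelax.maxOn (BoxRelax.expFun c) (BoxRelax.box v₀ u))) ∧
    -- the limit for the concave envelope
    Filter.Tendsto
      (fun u : ℝ => u ^ d * BoxRelax.cutOffRatio (BoxRelax.expFun c) (BoxRelax.box v₀ u)
        (BoxRelax.concEnv (BoxRelax.expFun c) (BoxRelax.box v₀ u)))
      Filter.atTop (nhds (((d : ℝ) + 1) / ∏ j, c j)) ∧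
    -- the limit for the constant upper bound
    Filter.Tendsto
      (fun u : ℝ => u ^ d * (((d : ℝ) + 1) *
        BoxRelax.cutOffRatio (BoxRelax.expFun c) (BoxRelax.box v₀ u)
          (fun _ => BoxRelax.maxOn (BoxRelax.expFun c) (BoxRelax.box v₀ u))))
      Filter.atTop (nhds (((d : ℝ) + 1) / ∏ j, c j)) ∧
    -- in particular both cut-off ratios tend to zero
    Filter.Tendsto
      (fun u : ℝ => BoxRelax.cutOffRatio (BoxRelax.expFun c) (BoxRelax.box v₀ u)
        (BoxRelax.concEnv (BoxRelax.expFun c) (BoxRelax.box v₀ u)))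
      Filter.atTop (nhds 0) ∧
    Filter.Tendsto
      (fun u : ℝ => BoxRelax.cutOffRatio (BoxRelax.expFun c) (BoxRelax.box v₀ u)
        (fun _ => BoxRelax.maxOn (BoxRelax.expFun c) (BoxRelax.box v₀ u)))
      Filter.atTop (nhds 0) := by
  have hconc := BoxRelax.tendsto_pow_mul_cutOffRatio_concEnv hd hc hv₀
  have hmax := BoxRelax.tendsto_pow_mul_cutOffRatio_maxOn hd hc hv₀
  refine ⟨fun u hu => ?_, fun u hu => BoxRelax.cutOff_concEnv_eq_cutOff_maxOn hd hc hv₀ hu, hconc,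
    ?_, BoxRelax.tendsto_zero_of_tendsto_pow_mul hd hconc,
    BoxRelax.tendsto_zero_of_tendsto_pow_mul hd hmax⟩
  · rw [BoxRelax.maxOn_expFun_box hc v₀ hu]
    exact ⟨BoxRelax.isGreatest_expFun_corner hc v₀ hu, rfl, BoxRelax.expFun_corner c v₀ u⟩
  · have h := hmax.const_mul ((d : ℝ) + 1)
    rw [mul_one_div] at h
    exact h.congr fun u => mul_left_comm _ _ _
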